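/- Let $\mathbf{k}$ be a field and let $\Lambda$ be a finite-dimensional (associative, unital) $\mathbf{k}$-algebra. Write $\operatorname{mod}\Lambda$ for the category of finitely generated $\Lambda$-modules, $\operatorname{proj}\Lambda$ for its full subcategory of projective modules, $\mathsf{D}^b(\operatorname{mod}\Lambda)$ for the bounded derived category and $\mathsf{K}^b(\operatorname{proj}\Lambda)$ for the homotopy category of bounded complexes over $\operatorname{proj}\Lambda$. Write $\Sigma$ for the suspension and $K_0(\mathsf{D})$ for the Grothendieck group of a triangulated category $\mathsf{D}$; $[D]$ is the class of an object $D$. A set of objects is called finite if it contains only finitely many objects up to isomorphism. (a) $\mathsf{D}^b(\operatorname{mod}\Lambda)$ is called discrete with respect to $\operatorname{mod}\Lambda$ (the heart of its standard t-structure, with cohomology functors $H^i$) if for every function $v\colon\mathbb{Z}\to K_0(\mathsf{D}^b(\operatorname{mod}\Lambda))$ (not necessarily a group homomorphism) the set of objects $$\{D\in\mathsf{D}^b(\operatorname{mod}\Lambda) \mid [H^i(D)]=v(i) \text{ for all } i\in\mathbb{Z}\}$$ is finite. (b) Put $\mathsf{D}=\mathsf{K}^b(\operatorname{proj}\Lambda)$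 and let $\mathsf{C}\subseteq\mathsf{D}$ be the full subcategory of objects isomorphic to a complex concentrated in degree $0$, which is identified with $\operatorname{proj}\Lambda$ (the co-heart of the natural co-t-structure on $\mathsf{D}$). Then $\mathsf{D}$ is called discrete with respect to $\operatorname{proj}\Lambda$ if for every function $v\colon\mathbb{Z}\to K_0(\mathsf{D})$ the set of those objects $D\in\mathsf{D}$ is finite which admit a tower $0=D_0\to D_1\to\cdots\to D_n=D$ with distinguished triangles $D_{j-1}\to D_j\to\Sigma^{i_j}C_j\to\Sigma D_{j-1}$ for $1\le j\le n$ (where $n\ge 0$), such that $C_1,\dots,C_n\in\mathsf{C}$, $i_1<\cdots<i_n$, $\{i_1,\dots,i_n\}=\{i\in\mathbb{Z}\mid v(i)\neq 0\}$, and $[C_j]=v(i_j)$ for all $j$. Corollary. If $\mathsf{D}^b(\operatorname{mod}\Lambda)$ is discrete with respect to $\operatorname{mod}\Lambda$, then $\mathsf{K}^b(\operatorname{proj}\Lambda)$ is discrete with respect to $\operatorname{proj}\Lambda$. -/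

import Mathlib

open CategoryTheory Limits Pretriangulated Triangulated

universe w v u u'

namespace TriDiscrete

/-! ### Sets of objects up to isomorphism -/

section FiniteUpToIso

variable {D : Type u} [Category.{v} D]

/-- There are only finitely many isomorphism classes of objects satisfying `P`. -/
def FiniteUpToIso (P : ObjectProperty D) : Prop :=
  (Quotient.mk (isIsomorphicSetoid D) '' {X : D | P X}).Finite

end FiniteUpToIso

/-! ### The two notions of discreteness in a triangulated category -/

section Triangulated

variable (D : Type u) [Category.{v} D] [Preadditive D] [HasZeroObject D] [HasShift D ℤ]
  [∀ n : ℤ, (shiftFunctor D n).Additive] [Pretriangulated D]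

/-- The relations `[X₂] = [X₁] + [X₃]` of the Grothendieck group, one for each distinguished
triangle `X₁ ⟶ X₂ ⟶ X₃ ⟶ X₁⟦1⟧`. -/
def k0Relations : Set (FreeAbelianGroup D) :=
  {r | ∃ T : Triangle D, T ∈ (distTriang D) ∧
    r = FreeAbelianGroup.of T.obj₂ - (FreeAbelianGroup.of T.obj₁ + FreeAbelianGroup.of T.obj₃)}

/-- The Grothendieck group `K₀(D)` of a triangulated category `D`. -/
abbrev K0 : Type u := FreeAbelianGroup D ⧸ AddSubgroup.closure (k0Relations D)

variable {D}

/-- The class `[X]` in `K₀(D)` of an object `X`. -/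
def K0.of (X : D) : K0 D :=
  QuotientAddGroup.mk' (AddSubgroup.closure (k0Relations D)) (FreeAbelianGroup.of X)

/-- The cohomology functor `Hⁱ` of a t-structure, with values in the heart (regarded inside
`D`): `Hⁱ(X)` is `τ^{≥ i} τ^{≤ i} X` shifted from degree `i` to degree `0`. -/
noncomputable def tCohomology (t : TStructure D) (i : ℤ) : D ⥤ D :=
  t.truncGELE i i ⋙ shiftFunctor D i

/-- `D` is discrete with respect to the heart of the t-structure `t`: for every function
`v : ℤ → K₀(D)` there are, up to isomorphism, only finitely many objects `X` with
`[Hⁱ(X)] = v(i)` for all `i`. -/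
def IsDiscreteWrtHeart (t : TStructure D) : Prop :=
  ∀ v : ℤ → K0 D, FiniteUpToIso fun X : D => ∀ i : ℤ, K0.of ((tCohomology t i).obj X) = v i

/-- A (finite) Postnikov tower of `X` with respect to the full subcategory `C`:
`0 = X₀ ⟶ X₁ ⟶ ⋯ ⟶ Xₙ = X` together with distinguished triangles
`Xⱼ ⟶ Xⱼ₊₁ ⟶ Cⱼ⟦dⱼ⟧ ⟶ Xⱼ⟦1⟧`, where the `Cⱼ` lie in `C` and `d₀ < d₁ < ⋯ < dₙ₋₁`. -/
structure PostnikovTower (C : ObjectProperty D) (X : D) where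
  /-- the length of the tower -/
  length : ℕ
  /-- the objects `X₀, …, Xₙ` of the tower -/
  obj : Fin (length + 1) → D
  isZero_bot : IsZero (obj 0)
  /-- the top of the tower is `X` -/
  topIso : obj (Fin.last length) ≅ X
  /-- the shifts occurring in the tower -/
  deg : Fin length → ℤ
  strictMono_deg : StrictMono deg
  /-- the objects of `C` occurring in the tower -/
  term : Fin length → D
  term_mem : ∀ j, C (term j)
  exists_triangle : ∀ j : Fin length,
    ∃ (f : obj j.castSucc ⟶ obj j.succ) (g : obj j.succ ⟶ (term j)⟦deg j⟧)
      (h : (term j)⟦deg j⟧ ⟶ (obj j.castSucc)⟦(1 : ℤ)⟧), Triangle.mk f g h ∈ (distTriang D)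

/-- `D` is discrete with respect to `C`, the co-heart of a bounded co-t-structure: for every
function `v : ℤ → K₀(D)` there are, up to isomorphism, only finitely many objects `X` which
admit a Postnikov tower whose set of shifts is the support of `v` and whose term with shift `d`
has class `v(d)`, for each `d` in the support. -/
def IsDiscreteWrtCoheart (C : ObjectProperty D) : Prop :=
  ∀ v : ℤ → K0 D, FiniteUpToIso fun X : D => ∃ T : PostnikovTower C X,
    Set.range T.deg = Function.support v ∧ ∀ j, K0.of (T.term j) = v (T.deg j)

end Triangulated

/-! ### The bounded homotopy category of an additive category -/

section Kb

open ZeroObject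

variable (A : Type u) [Category.{v} A] [Preadditive A] [HasZeroObject A] [HasBinaryBiproducts A]

/-- The objects of `K(A)` given by complexes which vanish in all but finitely many degrees. -/
def isBoundedComplex : ObjectProperty (HomotopyCategory A (ComplexShape.up ℤ)) := fun K =>
  ∃ a b : ℤ, CochainComplex.IsStrictlyGE K.as a ∧ CochainComplex.IsStrictlyLE K.as b

/-- `Kᵇ(A)`: the homotopy category of bounded complexes in `A`. -/
abbrev Kb := (isBoundedComplex A).FullSubcategory

/-- The full subcategory of `Kᵇ(A)` given by `A`, i.e. the objects isomorphic to a complex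
concentrated in degree `0`. -/
def stalkComplexes : ObjectProperty (Kb A) :=
  (HomotopyCategory.singleFunctor A 0).essImage.inverseImage (isBoundedComplex A).ι

instance : (isBoundedComplex A).ContainsZero where
  exists_zero :=
    ⟨(HomotopyCategory.quotient _ _).obj 0, Functor.map_isZero _ (isZero_zero _), 0, 0,
      (inferInstance : (0 : CochainComplex A ℤ).IsStrictlyGE 0),
      (inferInstance : (0 : CochainComplex A ℤ).IsStrictlyLE 0)⟩

instance : (isBoundedComplex A).IsStableUnderShift ℤ where
  isStableUnderShiftBy n :=
    { le_shift := fun K hK => by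
        obtain ⟨K : CochainComplex _ _, rfl⟩ := K.quotient_obj_surjective
        obtain ⟨a, b, (_ : K.IsStrictlyGE a), (_ : K.IsStrictlyLE b)⟩ := hK
        rw [ObjectProperty.prop_shift_iff, HomotopyCategory.shift_quotient_obj]
        exact ⟨a - n, b - n, K.isStrictlyGE_shift a n (a - n) (by lia),
          K.isStrictlyLE_shift b n (b - n) (by lia)⟩ }

instance : (isBoundedComplex A).IsTriangulatedClosed₃ where
  ext₃' T hT h₁ h₂ := by
    obtain ⟨a₁, b₁, _, _⟩ := h₁
    obtain ⟨a₂, b₂, _, _⟩ := h₂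
    obtain ⟨f : T.obj₁.as ⟶ T.obj₂.as, hf⟩ :=
      (HomotopyCategory.quotient _ _).map_surjective T.mor₁
    refine ⟨_, ?_, ⟨Triangle.π₃.mapIso (isoTriangleOfIso₁₂ T _ hT
      (HomotopyCategory.mappingCone_triangleh_distinguished f)
      (Iso.refl _) (Iso.refl _) ?_)⟩⟩
    · refine ⟨min (a₁ - 1) a₂, max b₁ b₂,
        CochainComplex.isStrictlyGE_mappingCone f a₁ a₂ _ (by simp) (by simp), ?_⟩
      refine (CochainComplex.isStrictlyLE_iff _ _).2 fun i hi => ?_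
      refine (CochainComplex.mappingCone.isZero_X_iff f i).2
        ⟨CochainComplex.isZero_of_isStrictlyLE _ b₁ _ ?_,
          CochainComplex.isZero_of_isStrictlyLE _ b₂ _ ?_⟩
      all_goals lia
    · exact (Category.comp_id _).trans (hf.symm.trans (Category.id_comp _).symm)

instance : (isBoundedComplex A).IsTriangulated where
  toIsTriangulatedClosed₂ := .of_isTriangulatedClosed₃

end Kb

/-! ### The category of finitely generated projective modules -/

section Proj

variable (R : Type u) [Ring R]

/-- Finitely generated projective modules, as a property of objects of `ModuleCat R`. -/
def isFGProj : ObjectProperty (ModuleCat.{v} R) := fun M =>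
  Module.Finite R M ∧ Module.Projective R M

/-- `proj R`: the category of finitely generated projective `R`-modules. -/
abbrev FGProj := (isFGProj.{v} R).FullSubcategory

instance : (isFGProj.{v} R).IsClosedUnderIsomorphisms where
  of_iso e h := by
    obtain ⟨_, _⟩ := h
    exact ⟨Module.Finite.equiv e.toLinearEquiv, Module.Projective.of_equiv e.toLinearEquiv⟩

instance : (isFGProj.{v} R).ContainsZero where
  exists_zero := ⟨ModuleCat.of R PUnit, ModuleCat.isZero_of_subsingleton _,
    (inferInstance : Module.Finite R PUnit.{v + 1}),
    (inferInstance : Module.Projective R PUnit.{v + 1})⟩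

instance : (isFGProj.{v} R).IsClosedUnderBinaryProducts where
  limitsOfShape_le := by
    rintro X ⟨p⟩
    obtain ⟨_, _⟩ := p.prop_diag_obj (.mk .left)
    obtain ⟨_, _⟩ := p.prop_diag_obj (.mk .right)
    let M := p.diag.obj (.mk .left)
    let N := p.diag.obj (.mk .right)
    have hMN : isFGProj R (ModuleCat.of R (M × N)) :=
      ⟨(inferInstance : Module.Finite R (M × N)), (inferInstance : Module.Projective R (M × N))⟩
    refine (isFGProj R).prop_of_iso ?_ hMN
    exact IsLimit.conePointUniqueUpToIso (ModuleCat.binaryProductLimitCone M N).isLimit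
      ((IsLimit.postcomposeHomEquiv (diagramIsoPair p.diag) _).2 p.isLimit)

instance : (isFGProj.{v} R).IsClosedUnderFiniteProducts := .mk'

instance : HasBinaryBiproducts (FGProj.{v} R) :=
  HasBinaryBiproducts.of_hasBinaryProducts

end Proj

end TriDiscrete

/-!
The bounded homotopy category `Kᵇ(proj Λ)` embeds fully faithfully into `Dᵇ(mod Λ)`, because
bounded complexes of projective modules are K-projective (`toDerived_map_bijective`). It therefore
suffices to see that the objects of `Kᵇ(proj Λ)` which have a Postnikov tower with classes `v` land
in finitely many of the sets which are finite by discreteness of `Dᵇ(mod Λ)`, i.e. that only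
finitely many functions `i ↦ [Hⁱ(X)]` occur for them.

Size is measured by the length over `Λ`. The Euler characteristic `∑ (-1)ⁱ ℓ(Hⁱ(X))` is additive on
distinguished triangles and so defines a homomorphism on `K₀(Kᵇ(proj Λ))` (`eulerK0`), whose value
on the class of a projective module in degree `0` is the length of that module. Hence the classes
`v(d)` determine the lengths of the terms of the tower, and the long exact sequences of its
triangles bound the length of `Hⁱ(X)` by that of the term with shift `-i`
(`hlen_toDerived_le_eulerK0`); in particular `Hⁱ(X) = 0` whenever `v(-i) = 0`. No uniqueness
statement for projective modules with a given class is needed.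

Finally, modules of bounded length have only finitely many classes in `K₀(Dᵇ(mod Λ))`, since such a
class is a sum of boundedly many classes of simple modules and `Λ` has finitely many simple
modules (`finite_modClass_len_le`). So for each of the finitely many `i` in question there are
finitely many possibilities for `[Hⁱ(X)]`, and `[Hⁱ(X)] = 0` for all other `i`.
-/

namespace TriDiscrete

/-! ### Length on finitely generated modules -/

section Length

variable {Λ : Type u} [Ring Λ]

/-- The length of a finitely generated module, as a natural number (it is `0` by convention for
a module of infinite length, which does not occur over an Artinian ring). -/
noncomputable def len (M : FGModuleCat.{u} Λ) : ℕ := (Module.length Λ M).toNat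

/-- The rank of a morphism: the length of its image. -/
noncomputable def rk {M N : FGModuleCat.{u} Λ} (f : M ⟶ N) : ℕ :=
  (Module.length Λ (LinearMap.range f.hom.hom)).toNat

lemma len_eq_of_iso {M N : FGModuleCat.{u} Λ} (e : M ≅ N) : len M = len N := by
  rw [len, len, (FGModuleCat.isoToLinearEquiv e).length_eq]

lemma len_eq_zero_of_isZero {M : FGModuleCat.{u} Λ} (h : IsZero M) : len M = 0 := by
  have : Subsingleton M :=
    ModuleCat.subsingleton_of_isZero (Functor.map_isZero (forget₂ _ (ModuleCat.{u} Λ)) h)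
  rw [len, Module.length_eq_zero, ENat.toNat_zero]

lemma exists_simple_submodule [IsArtinianRing Λ] (M : FGModuleCat.{u} Λ) [Nontrivial M] :
    ∃ T : Submodule Λ M, IsSimpleModule Λ T := by
  have := isAtomic_of_orderBot_wellFounded_lt
    (IsWellFounded.wf (α := Submodule Λ M) (r := (· < ·)))
  obtain ⟨T, hT⟩ := IsAtomic.exists_atom (Submodule Λ M)
  exact ⟨T, isSimpleModule_iff_isAtom.2 hT⟩

variable [IsNoetherianRing Λ]

/-- Rank–nullity for an exact sequence `X₁ ⟶ X₂ ⟶ X₃`: the kernel of the second map is the image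
of the first one. -/
lemma len_eq_rk_add_rk [IsArtinianRing Λ] {S : ShortComplex (FGModuleCat.{u} Λ)} (hS : S.Exact) :
    len S.X₂ = rk S.f + rk S.g := by
  have h : Function.Exact S.f.hom.hom S.g.hom.hom :=
    (ShortComplex.ShortExact.moduleCat_exact_iff_function_exact _).1
      (hS.map (forget₂ (FGModuleCat.{u} Λ) (ModuleCat.{u} Λ)))
  have h' := Module.length_eq_add_of_exact (LinearMap.range S.f.hom.hom).subtype
    S.g.hom.hom.rangeRestrict (Submodule.subtype_injective _) S.g.hom.hom.surjective_rangeRestrict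
    (by
      rw [LinearMap.exact_iff, Submodule.range_subtype, LinearMap.ker_rangeRestrict]
      exact h.linearMap_ker_eq)
  rw [len, rk, rk, ← ENat.toNat_add Module.length_ne_top Module.length_ne_top]
  exact congrArg ENat.toNat h'

/-- A submodule `T` of a finitely generated module `M` gives a short exact sequence
`T ⟶ M ⟶ M ⧸ T`. -/
noncomputable def submoduleSES (M : FGModuleCat.{u} Λ) (T : Submodule Λ M) :
    ShortComplex (FGModuleCat.{u} Λ) :=
  ShortComplex.mk (X₁ := FGModuleCat.of Λ T) (X₂ := FGModuleCat.of Λ M)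
    (X₃ := FGModuleCat.of Λ (M ⧸ T))
    (FGModuleCat.ofHom T.subtype) (FGModuleCat.ofHom T.mkQ) (by
      ext x
      exact (Submodule.Quotient.mk_eq_zero T).2 x.2)

lemma submoduleSES_shortExact (M : FGModuleCat.{u} Λ) (T : Submodule Λ M) :
    (submoduleSES M T).ShortExact := by
  let F := forget₂ (FGModuleCat.{u} Λ) (ModuleCat.{u} Λ)
  have hf : Mono (F.map (submoduleSES M T).f) :=
    (ModuleCat.mono_iff_injective _).2 T.subtype_injective
  have hg : Epi (F.map (submoduleSES M T).g) :=
    (ModuleCat.epi_iff_surjective _).2 T.mkQ_surjective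
  exact
    { exact := (ShortComplex.exact_map_iff_of_faithful _ F).1
        ((ShortComplex.ShortExact.moduleCat_exact_iff_function_exact _).2
          (LinearMap.exact_subtype_mkQ T))
      mono_f := F.mono_of_mono_map hf
      epi_g := F.epi_of_epi_map hg }

lemma len_submoduleSES [IsArtinianRing Λ] (M : FGModuleCat.{u} Λ) (T : Submodule Λ M) :
    len M = len (FGModuleCat.of Λ T) + len (FGModuleCat.of Λ (M ⧸ T)) := by
  rw [len, len, len, ← ENat.toNat_add Module.length_ne_top Module.length_ne_top]
  exact congrArg ENat.toNat (Module.length_eq_add_of_exact T.subtype T.mkQ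
    T.subtype_injective T.mkQ_surjective (LinearMap.exact_subtype_mkQ T))

lemma len_pos_of_nontrivial [IsArtinianRing Λ] (M : FGModuleCat.{u} Λ) [Nontrivial M] :
    0 < len M := by
  rw [len, Nat.pos_iff_ne_zero, ne_eq, ENat.toNat_eq_zero, not_or]
  exact ⟨Module.length_pos.ne', Module.length_ne_top⟩

end Length

/-! ### Lengths of cohomology and the Euler characteristic -/

section Cohomology

variable {Λ : Type u} [Ring Λ] [IsNoetherianRing Λ]
  [HasDerivedCategory.{w} (FGModuleCat.{u} Λ)]

open DerivedCategory

/-- The length of the `i`-th cohomology of an object of the derived category. -/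
noncomputable def hlen (i : ℤ) (X : DerivedCategory (FGModuleCat.{u} Λ)) : ℕ :=
  len ((homologyFunctor _ i).obj X)

lemma hlen_eq_of_iso (i : ℤ) {X Y : DerivedCategory (FGModuleCat.{u} Λ)} (e : X ≅ Y) :
    hlen i X = hlen i Y :=
  len_eq_of_iso ((homologyFunctor _ i).mapIso e)

lemma hlen_shift (X : DerivedCategory (FGModuleCat.{u} Λ)) (n i j : ℤ) (h : n + i = j) :
    hlen i (X⟦n⟧) = hlen j X :=
  len_eq_of_iso (((homologyFunctor (FGModuleCat.{u} Λ) 0).shiftIso n i j h).app X)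

lemma hlen_single (M : FGModuleCat.{u} Λ) : hlen 0 ((singleFunctor _ 0).obj M) = len M :=
  len_eq_of_iso ((singleFunctorCompHomologyFunctorIso (FGModuleCat.{u} Λ) 0).app M)

/-- The Euler characteristic `∑ (-1)ⁱ ℓ(Hⁱ(X))`. It is meaningful when only finitely many
cohomology objects are nonzero; otherwise the sum takes the value `0`. -/
noncomputable def euler (X : DerivedCategory (FGModuleCat.{u} Λ)) : ℤ :=
  ∑ᶠ i : ℤ, (i.negOnePow : ℤ) * hlen i X

lemma euler_eq_hlen_zero {X : DerivedCategory (FGModuleCat.{u} Λ)}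
    (h : ∀ i, i ≠ 0 → hlen i X = 0) : euler X = hlen 0 X := by
  rw [euler, finsum_eq_single _ 0 (fun i hi => by simp [h i hi])]
  simp

variable [IsArtinianRing Λ]

/-- The dimension count in the long exact cohomology sequence of a triangle: `a`, `b` and `c` are
the ranks of the maps occurring in it. -/
lemma exists_ranks {T : Triangle (DerivedCategory (FGModuleCat.{u} Λ))} (hT : T ∈ distTriang _) :
    ∃ a b c : ℤ → ℕ, ∀ i, hlen i T.obj₁ = c (i - 1) + a i ∧ hlen i T.obj₂ = a i + b i ∧
      hlen i T.obj₃ = b i + c i := by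
  refine ⟨fun i => rk ((homologyFunctor _ i).map T.mor₁),
    fun i => rk ((homologyFunctor _ i).map T.mor₂),
    fun i => rk (HomologySequence.δ T i (i + 1)), fun i => ⟨?_, ?_, ?_⟩⟩
  · have h : ∀ j (hj : i - 1 + 1 = j), rk (HomologySequence.δ T (i - 1) j hj) =
        rk (HomologySequence.δ T (i - 1) (i - 1 + 1)) := by
      rintro _ rfl
      rfl
    dsimp only
    rw [← h i (by lia)]
    exact len_eq_rk_add_rk (HomologySequence.exact₁ T hT (i - 1) i)
  · exact len_eq_rk_add_rk (HomologySequence.exact₂ T hT i)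
  · exact len_eq_rk_add_rk (HomologySequence.exact₃ T hT i (i + 1))

lemma hlen_obj₂_le {T : Triangle (DerivedCategory (FGModuleCat.{u} Λ))} (hT : T ∈ distTriang _)
    (i : ℤ) : hlen i T.obj₂ ≤ hlen i T.obj₁ + hlen i T.obj₃ := by
  obtain ⟨a, b, c, h⟩ := exists_ranks hT
  obtain ⟨h₁, h₂, h₃⟩ := h i
  lia

lemma hlen_obj₁_le {T : Triangle (DerivedCategory (FGModuleCat.{u} Λ))} (hT : T ∈ distTriang _)
    (i j : ℤ) (hij : i + 1 = j) (h₀ : hlen i T.obj₃ = 0) : hlen j T.obj₁ ≤ hlen j T.obj₂ := by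
  obtain ⟨a, b, c, h⟩ := exists_ranks hT
  obtain ⟨h₁, h₂, -⟩ := h j
  obtain ⟨-, -, h₃⟩ := h i
  obtain rfl : i = j - 1 := by lia
  lia

lemma hlen_obj₃_le {T : Triangle (DerivedCategory (FGModuleCat.{u} Λ))} (hT : T ∈ distTriang _)
    (i j : ℤ) (hij : i + 1 = j) (h₀ : hlen j T.obj₁ = 0) : hlen i T.obj₃ ≤ hlen i T.obj₂ := by
  obtain ⟨a, b, c, h⟩ := exists_ranks hT
  obtain ⟨h₁, -, -⟩ := h j
  obtain ⟨-, h₂, h₃⟩ := h i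
  obtain rfl : i = j - 1 := by lia
  lia

lemma euler_obj₂ {T : Triangle (DerivedCategory (FGModuleCat.{u} Λ))} (hT : T ∈ distTriang _)
    (h₁ : (Function.support fun i => hlen i T.obj₁).Finite)
    (h₃ : (Function.support fun i => hlen i T.obj₃).Finite) :
    euler T.obj₂ = euler T.obj₁ + euler T.obj₃ := by
  obtain ⟨a, b, c, h⟩ := exists_ranks hT
  have key : ∀ d : ℤ → ℕ, (Function.support d).Finite →
      (Function.support fun i : ℤ => (i.negOnePow : ℤ) * d i).Finite := fun d hd =>
    hd.subset fun i hi => by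
      rw [Function.mem_support] at hi ⊢
      rintro h0
      simp [h0] at hi
  have ha := key a (h₁.subset fun i hi => by
    have := (h i).1; simp only [Function.mem_support] at hi ⊢; lia)
  have hb := key b (h₃.subset fun i hi => by
    have := (h i).2.2; simp only [Function.mem_support] at hi ⊢; lia)
  have hc := key c (h₃.subset fun i hi => by
    have := (h i).2.2; simp only [Function.mem_support] at hi ⊢; lia)
  have hc' : (Function.support fun i : ℤ => (i.negOnePow : ℤ) * c (i - 1)).Finite := by
    apply key (fun i => c (i - 1))
    refine h₁.subset fun i hi => ?_
    have := (h i).1; simp only [Function.mem_support] at hi ⊢; lia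
  have e₁ : euler T.obj₁ = ∑ᶠ i : ℤ, (i.negOnePow : ℤ) * c (i - 1) +
      ∑ᶠ i : ℤ, (i.negOnePow : ℤ) * a i := by
    rw [← finsum_add_distrib hc' ha, euler]
    exact finsum_congr fun i => by rw [(h i).1]; push_cast; ring
  have e₂ : euler T.obj₂ = ∑ᶠ i : ℤ, (i.negOnePow : ℤ) * a i +
      ∑ᶠ i : ℤ, (i.negOnePow : ℤ) * b i := by
    rw [← finsum_add_distrib ha hb, euler]
    exact finsum_congr fun i => by rw [(h i).2.1]; push_cast; ring
  have e₃ : euler T.obj₃ = ∑ᶠ i : ℤ, (i.negOnePow : ℤ) * b i +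
      ∑ᶠ i : ℤ, (i.negOnePow : ℤ) * c i := by
    rw [← finsum_add_distrib hb hc, euler]
    exact finsum_congr fun i => by rw [(h i).2.2]; push_cast; ring
  -- reindexing the ranks of the connecting maps by `i ↦ i + 1` changes the sign
  have e₄ : ∑ᶠ i : ℤ, (i.negOnePow : ℤ) * c (i - 1) = -∑ᶠ i : ℤ, (i.negOnePow : ℤ) * c i := by
    rw [← finsum_neg_distrib, ← finsum_comp_equiv (Equiv.addRight (1 : ℤ))]
    exact finsum_congr fun i => by simp [Int.negOnePow_succ]
  rw [e₁, e₂, e₃, e₄]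
  ring

end Cohomology

/-! ### The cohomology of the standard t-structure -/

section TStructure

variable {Λ : Type u} [Ring Λ] [IsNoetherianRing Λ]
  [HasDerivedCategory.{w} (FGModuleCat.{u} Λ)]

open DerivedCategory

/-- A module, regarded as an object of the bounded derived category. -/
noncomputable def boundedSingle (M : FGModuleCat.{u} Λ) : Bounded (FGModuleCat.{u} Λ) :=
  ⟨(singleFunctor _ 0).obj M, ⟨0, (inferInstance : IsGE _ 0)⟩, ⟨0, (inferInstance : IsLE _ 0)⟩⟩

/-- The cohomology `Hⁱ(X)` of the standard t-structure is a module whose length is at most that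
of the usual cohomology in degree `i` (the two agree, but only this bound is needed). -/
lemma exists_iso_tCohomology [IsArtinianRing Λ] (X : Bounded (FGModuleCat.{u} Λ)) (i : ℤ) :
    ∃ M : FGModuleCat.{u} Λ, len M ≤ hlen i X.obj ∧
      Nonempty ((tCohomology TStructure.t.onBounded i).obj X ≅ boundedSingle M) := by
  let t := (TStructure.t : TStructure (DerivedCategory (FGModuleCat.{u} Λ)))
  let Y := (tCohomology t.onBounded i).obj X
  let Z := (t.onBounded.truncLE i).obj X
  let W := (t.onBounded.truncGE i).obj Z
  have hW₁ : t.onBounded.IsGE W i := inferInstance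
  have hW₂ : t.onBounded.IsLE W i :=
    (inferInstance : t.onBounded.IsLE ((t.onBounded.truncGELE i i).obj X) i)
  have hY₁ : IsGE Y.obj 0 := (t.bounded.tStructure_isGE_iff t Y 0).1
    (t.onBounded.isGE_shift W i i 0 (by lia))
  have hY₂ : IsLE Y.obj 0 := (t.bounded.tStructure_isLE_iff t Y 0).1
    (t.onBounded.isLE_shift W i i 0 (by lia))
  obtain ⟨M, ⟨e⟩⟩ := exists_iso_singleFunctor_obj_of_isGE_of_isLE Y.obj 0
  refine ⟨M, ?_, ⟨t.bounded.ι.preimageIso e⟩⟩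
  have h₁ : len M = hlen i W.obj := by
    rw [← hlen_single, ← hlen_eq_of_iso 0 e]
    exact (hlen_eq_of_iso 0 ((t.bounded.ι.commShiftIso i).app W)).trans
      (hlen_shift W.obj i 0 i (by lia))
  have h₂ : hlen i W.obj ≤ hlen i Z.obj := by
    refine hlen_obj₃_le (t.bounded.ι.map_distinguished _
      (t.onBounded.triangleLTGE_distinguished i Z)) i (i + 1) rfl ?_
    have : IsLE ((t.onBounded.truncLT i).obj Z).obj (i - 1) :=
      (t.bounded.tStructure_isLE_iff t _ _).1 inferInstance
    exact len_eq_zero_of_isZero (isZero_of_isLE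
      ((t.onBounded.truncLT i).obj Z).obj (i - 1) (i + 1) (by lia))
  have h₃ : hlen i Z.obj ≤ hlen i X.obj := by
    refine hlen_obj₁_le (t.bounded.ι.map_distinguished _
      (t.onBounded.triangleLEGE_distinguished i (i + 1) rfl X)) (i - 1) i (by lia) ?_
    have : IsGE ((t.onBounded.truncGE (i + 1)).obj X).obj (i + 1) :=
      (t.bounded.tStructure_isGE_iff t _ _).1 inferInstance
    exact len_eq_zero_of_isZero (isZero_of_isGE
      ((t.onBounded.truncGE (i + 1)).obj X).obj (i + 1) (i - 1) (by lia))
  exact h₁.le.trans (h₂.trans h₃)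

end TStructure

/-! ### Classes of modules in the Grothendieck group -/

section K0

open ZeroObject

variable {D : Type u} [Category.{v} D] [Preadditive D] [HasZeroObject D] [HasShift D ℤ]
  [∀ n : ℤ, (shiftFunctor D n).Additive] [Pretriangulated D]

lemma K0.of_obj₂ {T : Triangle D} (hT : T ∈ distTriang D) :
    K0.of T.obj₂ = K0.of T.obj₁ + K0.of T.obj₃ := by
  rw [K0.of, K0.of, K0.of, ← map_add, ← sub_eq_zero, ← map_sub]
  exact (QuotientAddGroup.eq_zero_iff _).2 (AddSubgroup.subset_closure ⟨T, hT, rfl⟩)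

lemma K0.of_eq_zero {X : D} (hX : IsZero X) : K0.of X = 0 := by
  have h := K0.of_obj₂ (isomorphic_distinguished _ (contractible_distinguished X)
    (Triangle.mk (𝟙 X) (𝟙 X) 0)
    (Triangle.isoMk _ _ (Iso.refl _) (Iso.refl _) (hX.iso (isZero_zero D)) (by cat_disch)
      (hX.eq_of_src _ _) (hX.eq_of_src _ _)))
  simpa using h

lemma K0.of_eq_of_iso {X Y : D} (e : X ≅ Y) : K0.of X = K0.of Y := by
  have hT : Triangle.mk e.hom (0 : Y ⟶ 0) 0 ∈ distTriang D :=
    isomorphic_distinguished _ (contractible_distinguished X) _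
      (Triangle.isoMk _ _ (Iso.refl _) e.symm (Iso.refl _)
        (e.hom_inv_id.trans (Category.comp_id _).symm)
        (zero_comp.trans comp_zero.symm) (zero_comp.trans comp_zero.symm))
  have h := K0.of_obj₂ hT
  simpa [K0.of_eq_zero (isZero_zero D)] using h.symm

/-- A function on objects which is additive on distinguished triangles factors through `K₀`. -/
noncomputable def K0.lift (χ : D → ℤ)
    (hχ : ∀ T ∈ distTriang D, χ T.obj₂ = χ T.obj₁ + χ T.obj₃) : K0 D →+ ℤ :=
  QuotientAddGroup.lift _ (FreeAbelianGroup.lift χ) <| by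
    rw [AddSubgroup.closure_le]
    rintro _ ⟨T, hT, rfl⟩
    simp [hχ T hT]

lemma K0.lift_of (χ : D → ℤ) (hχ : ∀ T ∈ distTriang D, χ T.obj₂ = χ T.obj₁ + χ T.obj₃) (X : D) :
    K0.lift χ hχ (K0.of X) = χ X :=
  FreeAbelianGroup.lift_apply_of χ X

end K0

section FiniteClasses

variable {Λ : Type u} [Ring Λ] [IsNoetherianRing Λ]
  [HasDerivedCategory.{w} (FGModuleCat.{u} Λ)]

open DerivedCategory

/-- The class of a finitely generated module in `K₀(Dᵇ(mod Λ))`. -/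
noncomputable def modClass (M : FGModuleCat.{u} Λ) : K0 (Bounded (FGModuleCat.{u} Λ)) :=
  K0.of (boundedSingle M)

lemma modClass_eq_of_iso {M N : FGModuleCat.{u} Λ} (e : M ≅ N) : modClass M = modClass N :=
  K0.of_eq_of_iso ((TStructure.t.bounded).ι.preimageIso ((singleFunctor _ 0).mapIso e))

lemma modClass_eq_zero (M : FGModuleCat.{u} Λ) [Subsingleton M] : modClass M = 0 := by
  refine K0.of_eq_zero (IsZero.of_full_of_faithful_of_isZero (TStructure.t.bounded).ι _ ?_)
  refine (singleFunctor (FGModuleCat.{u} Λ) 0).map_isZero ?_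
  exact IsZero.of_full_of_faithful_of_isZero (forget₂ _ (ModuleCat.{u} Λ)) _
    (@ModuleCat.isZero_of_subsingleton _ _ ((forget₂ _ (ModuleCat.{u} Λ)).obj M) ‹_›)

lemma modClass_X₂ {S : ShortComplex (FGModuleCat.{u} Λ)} (hS : S.ShortExact) :
    modClass S.X₂ = modClass S.X₁ + modClass S.X₃ := by
  let P := (TStructure.t : TStructure (DerivedCategory (FGModuleCat.{u} Λ))).bounded
  let f : boundedSingle S.X₁ ⟶ boundedSingle S.X₂ := P.homMk ((singleFunctor _ 0).map S.f)
  let g : boundedSingle S.X₂ ⟶ boundedSingle S.X₃ := P.homMk ((singleFunctor _ 0).map S.g)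
  let δ : P.ι.obj (boundedSingle S.X₃) ⟶ (P.ι.obj (boundedSingle S.X₁))⟦(1 : ℤ)⟧ := hS.singleδ
  let h : boundedSingle S.X₃ ⟶ (boundedSingle S.X₁)⟦(1 : ℤ)⟧ :=
    P.fullyFaithfulι.preimage
      (δ ≫ (P.ι.commShiftIso (1 : ℤ)).inv.app (boundedSingle S.X₁))
  refine K0.of_obj₂ (T := Triangle.mk f g h) ?_
  rw [← P.ι.map_distinguished_iff]
  refine isomorphic_distinguished _ hS.singleTriangle_distinguished _
    (Triangle.isoMk _ _ (Iso.refl _) (Iso.refl _) (Iso.refl _) ?_ ?_ ?_)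
  · exact (Category.comp_id _).trans (Category.id_comp _).symm
  · exact (Category.comp_id _).trans (Category.id_comp _).symm
  · have hδ : P.ι.map h ≫ (P.ι.commShiftIso (1 : ℤ)).hom.app (boundedSingle S.X₁) = δ := by
      rw [Functor.FullyFaithful.map_preimage, Category.assoc, Iso.inv_hom_id_app]
      exact Category.comp_id _
    refine Eq.trans ?_ (hδ.trans (Category.id_comp _).symm)
    refine Eq.trans ?_ (Category.comp_id _)
    exact congrArg _ (CategoryTheory.Functor.map_id _ _)

/-- Up to its class in `K₀`, a finite length module has only finitely many simple quotients: if
`T` is a simple submodule of `M`, a simple quotient of `M` is either isomorphic to `T` or a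
quotient of `M ⧸ T`. -/
lemma finite_modClass_simpleQuotients [IsArtinianRing Λ] (n : ℕ) :
    ∀ M : FGModuleCat.{u} Λ, len M ≤ n →
      {x | ∃ S : FGModuleCat.{u} Λ, IsSimpleModule Λ S ∧
        (∃ f : M →ₗ[Λ] S, Function.Surjective f) ∧ modClass S = x}.Finite := by
  induction n with
  | zero =>
    intro M hM
    have : Subsingleton M := by
      by_contra h
      rw [not_subsingleton_iff_nontrivial] at h
      exact absurd (len_pos_of_nontrivial M) (by lia)
    refine Set.finite_empty.subset ?_
    rintro _ ⟨S, hS, ⟨f, hf⟩, -⟩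
    have := IsSimpleModule.nontrivial Λ S
    exact not_subsingleton S hf.subsingleton
  | succ n ih =>
    intro M hM
    rcases subsingleton_or_nontrivial M with h | h
    · exact ih M (by rw [len, Module.length_eq_zero]; simp)
    obtain ⟨T, hT⟩ := exists_simple_submodule M
    have := IsSimpleModule.nontrivial Λ T
    have h₁ := len_submoduleSES M T
    have h₂ := len_pos_of_nontrivial (FGModuleCat.of Λ T)
    refine ((ih (FGModuleCat.of Λ (M ⧸ T)) (by lia)).insert
      (modClass (FGModuleCat.of Λ T))).subset ?_
    rintro _ ⟨S, hS, ⟨f, hf⟩, rfl⟩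
    rcases LinearMap.bijective_or_eq_zero (f ∘ₗ T.subtype) with h | h
    · left
      exact modClass_eq_of_iso (LinearEquiv.ofBijective _ h).symm.toFGModuleCatIso
    · right
      refine ⟨S, hS, ⟨T.liftQ f fun x hx => LinearMap.congr_fun h ⟨x, hx⟩, ?_⟩, rfl⟩
      intro y
      obtain ⟨x, rfl⟩ := hf y
      exact ⟨T.mkQ x, rfl⟩

/-- An Artinian ring has only finitely many simple modules, since each of them is a quotient of
the ring. -/
lemma finite_modClass_simple [IsArtinianRing Λ] :
    {x | ∃ S : FGModuleCat.{u} Λ, IsSimpleModule Λ S ∧ modClass S = x}.Finite := by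
  refine (finite_modClass_simpleQuotients _ (FGModuleCat.of Λ Λ) le_rfl).subset ?_
  rintro _ ⟨S, hS, rfl⟩
  have := IsSimpleModule.nontrivial Λ S
  obtain ⟨s, hs⟩ := exists_ne (0 : S)
  exact ⟨S, hS, ⟨LinearMap.toSpanSingleton Λ S s, IsSimpleModule.toSpanSingleton_surjective Λ hs⟩,
    rfl⟩

lemma modClass_eq_zero_of_len [IsArtinianRing Λ] (M : FGModuleCat.{u} Λ) (hM : len M = 0) :
    modClass M = 0 := by
  rcases subsingleton_or_nontrivial M with h | h
  · exact modClass_eq_zero M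
  · exact absurd (len_pos_of_nontrivial M) (by lia)

/-- Modules of bounded length have only finitely many classes in `K₀`: the class is a sum of
boundedly many classes of simple modules. -/
lemma finite_modClass_len_le [IsArtinianRing Λ] (n : ℕ) :
    {x | ∃ M : FGModuleCat.{u} Λ, len M ≤ n ∧ modClass M = x}.Finite := by
  induction n with
  | zero =>
    refine (Set.finite_singleton 0).subset ?_
    rintro _ ⟨M, hM, rfl⟩
    exact modClass_eq_zero_of_len M (by lia)
  | succ n ih =>
    refine ((finite_modClass_simple.image2 (· + ·) ih).insert 0).subset ?_
    rintro _ ⟨M, hM, rfl⟩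
    rcases subsingleton_or_nontrivial M with h | h
    · exact Or.inl (modClass_eq_zero M)
    · obtain ⟨T, hT⟩ := exists_simple_submodule M
      have := IsSimpleModule.nontrivial Λ T
      have h₁ := len_submoduleSES M T
      have h₂ := len_pos_of_nontrivial (FGModuleCat.of Λ T)
      exact Or.inr ⟨_, ⟨FGModuleCat.of Λ T, hT, rfl⟩, _,
        ⟨FGModuleCat.of Λ (M ⧸ T), by lia, rfl⟩, (modClass_X₂ (submoduleSES_shortExact M T)).symm⟩

end FiniteClasses

/-! ### The embedding of `Kᵇ(proj Λ)` into the derived category -/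

section Comparison

variable (Λ : Type u) [Ring Λ]

/-- The inclusion of finitely generated projective modules into finitely generated modules. -/
def projInclusion : FGProj.{u} Λ ⥤ FGModuleCat.{u} Λ :=
  ObjectProperty.ιOfLE (P := isFGProj.{u} Λ) (P' := ModuleCat.isFG Λ) fun _ h => h.1

instance : (projInclusion Λ).Full := ObjectProperty.full_ιOfLE _

instance : (projInclusion Λ).Faithful := ObjectProperty.faithful_ιOfLE _

instance : (projInclusion Λ).Additive where

instance projective_projInclusion_obj [IsNoetherianRing Λ] (P : FGProj.{u} Λ) :
    Projective ((projInclusion Λ).obj P) where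
  factors {E X} f e he := by
    have hP : Module.Projective Λ ((projInclusion Λ).obj P).obj := P.property.2
    have he' : Function.Surjective e.hom.hom :=
      (ModuleCat.epi_iff_surjective _).1
        (inferInstance : Epi ((forget₂ (FGModuleCat.{u} Λ) (ModuleCat.{u} Λ)).map e))
    obtain ⟨g, hg⟩ := Module.projective_lifting_property e.hom.hom f.hom.hom he'
    exact ⟨ObjectProperty.homMk (ModuleCat.ofHom g), FGModuleCat.hom_ext hg⟩

variable [IsNoetherianRing Λ] [HasDerivedCategory.{w} (FGModuleCat.{u} Λ)]

/-- The comparison functor `Kᵇ(proj Λ) ⥤ D(mod Λ)`. -/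
noncomputable def toDerived : Kb (FGProj.{u} Λ) ⥤ DerivedCategory (FGModuleCat.{u} Λ) :=
  (isBoundedComplex _).ι ⋙ (projInclusion Λ).mapHomotopyCategory (ComplexShape.up ℤ) ⋙
    DerivedCategory.Qh

noncomputable instance : (toDerived Λ).CommShift ℤ := by
  unfold toDerived
  infer_instance

instance : (toDerived Λ).IsTriangulated := by
  unfold toDerived
  infer_instance

/-- Bounded complexes of projective modules are K-projective, so morphisms between them in the
homotopy category and in the derived category agree. -/
lemma toDerived_map_bijective (X Y : Kb (FGProj.{u} Λ)) :
    Function.Bijective ((toDerived Λ).map : (X ⟶ Y) → _) := by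
  obtain ⟨a, b, -, hb⟩ := X.property
  let K : CochainComplex (FGModuleCat.{u} Λ) ℤ :=
    ((projInclusion Λ).mapHomologicalComplex (ComplexShape.up ℤ)).obj X.obj.as
  have hK : CochainComplex.IsStrictlyLE K b := by
    refine (CochainComplex.isStrictlyLE_iff _ _).2 fun i hi => ?_
    exact (projInclusion Λ).map_isZero (CochainComplex.isZero_of_isStrictlyLE X.obj.as b i hi)
  have hK' : ∀ n, Projective (K.X n) := fun n => projective_projInclusion_obj Λ (X.obj.as.X n)
  have := CochainComplex.isKProjective_of_projective K b
  have h₁ := CochainComplex.IsKProjective.Qh_map_bijective K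
    (((projInclusion Λ).mapHomotopyCategory (ComplexShape.up ℤ)).obj Y.obj)
  have h₂ := ((isBoundedComplex (FGProj.{u} Λ)).fullyFaithfulι.comp
    (Functor.FullyFaithful.ofFullyFaithful
      ((projInclusion Λ).mapHomotopyCategory (ComplexShape.up ℤ)))).map_bijective X Y
  exact h₁.comp h₂

instance : (toDerived Λ).Full := ⟨(toDerived_map_bijective Λ _ _).2⟩

instance : (toDerived Λ).Faithful := ⟨fun h => (toDerived_map_bijective Λ _ _).1 h⟩

variable {Λ}

lemma isZero_homology_Qh (K : CochainComplex (FGProj.{u} Λ) ℤ) (i : ℤ) (h : IsZero (K.X i)) :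
    IsZero ((DerivedCategory.homologyFunctor _ i).obj (DerivedCategory.Qh.obj
      (((projInclusion Λ).mapHomotopyCategory (ComplexShape.up ℤ)).obj
        ((HomotopyCategory.quotient _ _).obj K)))) := by
  let L : CochainComplex (FGModuleCat.{u} Λ) ℤ :=
    ((projInclusion Λ).mapHomologicalComplex (ComplexShape.up ℤ)).obj K
  have hL : IsZero (L.homology i) := (ShortComplex.exact_iff_isZero_homology _).1
    (ShortComplex.exact_of_isZero_X₂ (L.sc i) ((projInclusion Λ).map_isZero h))
  refine hL.of_iso ?_
  exact (DerivedCategory.homologyFunctor _ i).mapIso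
    ((DerivedCategory.quotientCompQhIso (FGModuleCat.{u} Λ)).app L) ≪≫
      (DerivedCategory.homologyFunctorFactors (FGModuleCat.{u} Λ) i).app L

lemma exists_isZero_homology_toDerived (X : Kb (FGProj.{u} Λ)) :
    ∃ a b : ℤ, ∀ i, i < a ∨ b < i →
      IsZero ((DerivedCategory.homologyFunctor _ i).obj ((toDerived Λ).obj X)) := by
  obtain ⟨a, b, ha, hb⟩ := X.property
  refine ⟨a, b, fun i hi => isZero_homology_Qh X.obj.as i ?_⟩
  rcases hi with hi | hi
  · exact CochainComplex.isZero_of_isStrictlyGE X.obj.as a i hi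
  · exact CochainComplex.isZero_of_isStrictlyLE X.obj.as b i hi

lemma finite_support_hlen_toDerived (X : Kb (FGProj.{u} Λ)) :
    (Function.support fun i => hlen i ((toDerived Λ).obj X)).Finite := by
  obtain ⟨a, b, h⟩ := exists_isZero_homology_toDerived X
  refine (Set.finite_Icc a b).subset fun i hi => ?_
  by_contra hi'
  rw [Set.mem_Icc, not_and_or, not_le, not_le] at hi'
  exact hi (len_eq_zero_of_isZero (h i hi'))

lemma bounded_toDerived_obj (X : Kb (FGProj.{u} Λ)) :
    (DerivedCategory.TStructure.t : TStructure (DerivedCategory (FGModuleCat.{u} Λ))).bounded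
      ((toDerived Λ).obj X) := by
  obtain ⟨a, b, h⟩ := exists_isZero_homology_toDerived X
  exact ⟨⟨a, (DerivedCategory.isGE_iff _ _).2 fun i hi => h i (Or.inl hi)⟩,
    ⟨b, (DerivedCategory.isLE_iff _ _).2 fun i hi => h i (Or.inr hi)⟩⟩

/-- The stalk complexes have cohomology only in degree `0`. -/
lemma hlen_toDerived_eq_zero_of_stalk {C : Kb (FGProj.{u} Λ)}
    (hC : stalkComplexes (FGProj.{u} Λ) C) (i : ℤ) (hi : i ≠ 0) :
    hlen i ((toDerived Λ).obj C) = 0 := by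
  obtain ⟨P, ⟨e⟩⟩ := hC
  refine (hlen_eq_of_iso i (((projInclusion Λ).mapHomotopyCategory (ComplexShape.up ℤ) ⋙
    DerivedCategory.Qh).mapIso e)).symm.trans ?_
  exact len_eq_zero_of_isZero <| isZero_homology_Qh
    ((HomologicalComplex.single _ (ComplexShape.up ℤ) 0).obj P) i
    (HomologicalComplex.isZero_single_obj_X _ _ _ _ hi)

lemma hlen_toDerived_shift (C : Kb (FGProj.{u} Λ)) (d i : ℤ) :
    hlen i ((toDerived Λ).obj (C⟦d⟧)) = hlen (d + i) ((toDerived Λ).obj C) :=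
  (hlen_eq_of_iso i (((toDerived Λ).commShiftIso d).app C)).trans (hlen_shift _ d i _ rfl)

variable [IsArtinianRing Λ]

lemma euler_toDerived_obj₂ (T : Triangle (Kb (FGProj.{u} Λ))) (hT : T ∈ distTriang _) :
    euler ((toDerived Λ).obj T.obj₂) =
      euler ((toDerived Λ).obj T.obj₁) + euler ((toDerived Λ).obj T.obj₃) := by
  have h := (toDerived Λ).map_distinguished T hT
  have h' := euler_obj₂ h
  exact h' (finite_support_hlen_toDerived T.obj₁) (finite_support_hlen_toDerived T.obj₃)

variable (Λ) in
/-- The Euler characteristic on `K₀(Kᵇ(proj Λ))`. -/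
noncomputable def eulerK0 : K0 (Kb (FGProj.{u} Λ)) →+ ℤ :=
  K0.lift (fun X => euler ((toDerived Λ).obj X)) euler_toDerived_obj₂

lemma eulerK0_of_stalk {C : Kb (FGProj.{u} Λ)} (hC : stalkComplexes (FGProj.{u} Λ) C) :
    eulerK0 Λ (K0.of C) = hlen 0 ((toDerived Λ).obj C) :=
  (K0.lift_of _ _ C).trans (euler_eq_hlen_zero (hlen_toDerived_eq_zero_of_stalk hC))

/-- Along a Postnikov tower, the cohomology is bounded by that of the terms. -/
lemma hlen_toDerived_le_sum {P : ObjectProperty (Kb (FGProj.{u} Λ))} {X : Kb (FGProj.{u} Λ)}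
    (T : PostnikovTower P X) (i : ℤ) :
    hlen i ((toDerived Λ).obj X) ≤
      ∑ j, hlen (T.deg j + i) ((toDerived Λ).obj (T.term j)) := by
  have key : ∀ m : Fin (T.length + 1), hlen i ((toDerived Λ).obj (T.obj m)) ≤
      ∑ j with j.castSucc < m, hlen (T.deg j + i) ((toDerived Λ).obj (T.term j)) := by
    intro m
    induction m using Fin.induction with
    | zero =>
      have h₀ : hlen i ((toDerived Λ).obj (T.obj 0)) = 0 := len_eq_zero_of_isZero
        ((DerivedCategory.homologyFunctor _ i).map_isZero ((toDerived Λ).map_isZero T.isZero_bot))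
      rw [h₀]
      exact Nat.zero_le _
    | succ l ih =>
      obtain ⟨f, g, h, hT⟩ := T.exists_triangle l
      have h₁ := hlen_obj₂_le ((toDerived Λ).map_distinguished _ hT) i
      have h₂ := hlen_toDerived_shift (T.term l) (T.deg l) i
      have h₃ : (Finset.univ.filter fun j : Fin T.length => j.castSucc < l.succ) =
          insert l (Finset.univ.filter fun j : Fin T.length => j.castSucc < l.castSucc) := by
        ext j
        simp only [Finset.mem_filter, Finset.mem_univ, true_and, Finset.mem_insert,
          Fin.castSucc_lt_succ_iff, Fin.castSucc_lt_castSucc_iff]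
        exact le_iff_eq_or_lt
      rw [h₃, Finset.sum_insert (by simp), ← h₂, add_comm]
      exact h₁.trans (Nat.add_le_add_right ih _)
  rw [← hlen_eq_of_iso i ((toDerived Λ).mapIso T.topIso)]
  refine (key _).trans (Finset.sum_le_sum_of_subset (Finset.filter_subset _ _))

/-- The classes of the terms of a Postnikov tower bound the length of the cohomology, because the
class of a stalk complex `P` determines the length of `P`. -/
lemma hlen_toDerived_le_eulerK0 {v : ℤ → K0 (Kb (FGProj.{u} Λ))} {X : Kb (FGProj.{u} Λ)}
    (T : PostnikovTower (stalkComplexes (FGProj.{u} Λ)) X)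
    (hT : ∀ j, K0.of (T.term j) = v (T.deg j)) (i : ℤ) :
    hlen i ((toDerived Λ).obj X) ≤ (eulerK0 Λ (v (-i))).toNat := by
  refine (hlen_toDerived_le_sum T i).trans ?_
  -- the shifts are distinct, so at most one term of the sum is nonzero
  have h₀ : ∀ j, T.deg j ≠ -i → hlen (T.deg j + i) ((toDerived Λ).obj (T.term j)) = 0 :=
    fun j hj => hlen_toDerived_eq_zero_of_stalk (T.term_mem j) _ (by lia)
  by_cases h : ∃ j, T.deg j = -i
  · obtain ⟨j, hj⟩ := h
    rw [Finset.sum_eq_single j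
      (fun l _ hl => h₀ l fun hl' => hl (T.strictMono_deg.injective (hl'.trans hj.symm)))
      (fun hj' => absurd (Finset.mem_univ j) hj'), ← hj, ← hT j, eulerK0_of_stalk (T.term_mem j),
      Int.toNat_natCast, hj, neg_add_cancel]
  · rw [Finset.sum_eq_zero fun j _ => h₀ j fun hj => h ⟨j, hj⟩]
    exact Nat.zero_le _

end Comparison

/-! ### Discreteness -/

section Discrete

/-- Functions taking values in prescribed finite sets, which are `{0}` outside a finite set of
indices, form a finite set. -/
lemma finite_setOf_forall_mem {ι M : Type*} [Zero M] (S : ι → Set M) (I : Set ι) (hI : I.Finite)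
    (hS : ∀ i, (S i).Finite) (h₀ : ∀ i, i ∉ I → S i ⊆ {0}) :
    {w : ι → M | ∀ i, w i ∈ S i}.Finite := by
  classical
  have := hI.to_subtype
  refine ((Set.Finite.pi' fun i : I => hS i).image
    fun w i => if h : i ∈ I then w ⟨i, h⟩ else 0).subset fun w hw => ?_
  refine ⟨fun i => w i, fun i => hw i, funext fun i => ?_⟩
  by_cases h : i ∈ I
  · simp [h]
  · simp [h, show w i = 0 from h₀ i h (hw i)]

variable (Λ : Type u) [Ring Λ] [IsNoetherianRing Λ]
  [HasDerivedCategory.{w} (FGModuleCat.{u} Λ)]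

/-- The comparison functor `Kᵇ(proj Λ) ⥤ Dᵇ(mod Λ)`. -/
noncomputable def toBounded : Kb (FGProj.{u} Λ) ⥤ DerivedCategory.Bounded (FGModuleCat.{u} Λ) :=
  ObjectProperty.lift _ (toDerived Λ) bounded_toDerived_obj

/-- The comparison functor is injective on isomorphism classes, being fully faithful. -/
lemma isIsomorphic_of_toBounded {X Y : Kb (FGProj.{u} Λ)}
    (h : IsIsomorphic ((toBounded Λ).obj X) ((toBounded Λ).obj Y)) : IsIsomorphic X Y := by
  obtain ⟨e⟩ := h
  exact ⟨(toDerived Λ).preimageIso (DerivedCategory.Bounded.ι.mapIso e)⟩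

/-- The implication over an arbitrary Artinian ring: the objects counted for a given `v` have
cohomology of bounded length, hence only finitely many functions `ℤ → K₀(Dᵇ(mod Λ))` arise as the
classes of their cohomology. -/
theorem isDiscreteWrtCoheart_of_isDiscreteWrtHeart [IsArtinianRing Λ]
    (H : IsDiscreteWrtHeart (DerivedCategory.TStructure.t :
      TStructure (DerivedCategory (FGModuleCat.{u} Λ))).onBounded) :
    IsDiscreteWrtCoheart (stalkComplexes (FGProj.{u} Λ)) := by
  intro v
  by_cases hv : (Function.support v).Finite
  swap
  · -- a Postnikov tower has finite length
    refine Set.finite_empty.subset ?_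
    rintro _ ⟨X, ⟨T, hT, -⟩, rfl⟩
    exact hv (hT ▸ Set.finite_range T.deg)
  let S : ℤ → Set (K0 (DerivedCategory.Bounded (FGModuleCat.{u} Λ))) := fun i =>
    {x | ∃ M : FGModuleCat.{u} Λ, len M ≤ (eulerK0 Λ (v (-i))).toNat ∧ modClass M = x}
  have hS : {w : ℤ → _ | ∀ i, w i ∈ S i}.Finite := by
    refine finite_setOf_forall_mem S (Neg.neg ⁻¹' Function.support v)
      (hv.preimage neg_injective.injOn) (fun i => finite_modClass_len_le _) ?_
    rintro i hi _ ⟨M, hM, rfl⟩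
    rw [Set.mem_preimage, Function.mem_support, not_not] at hi
    rw [hi, map_zero, Int.toNat_zero, Nat.le_zero] at hM
    exact modClass_eq_zero_of_len M hM
  let φ : Quotient (isIsomorphicSetoid (Kb (FGProj.{u} Λ))) →
      Quotient (isIsomorphicSetoid (DerivedCategory.Bounded (FGModuleCat.{u} Λ))) :=
    Quotient.map (toBounded Λ).obj fun _ _ ⟨e⟩ => ⟨(toBounded Λ).mapIso e⟩
  have hφ : Function.Injective φ := by
    rintro ⟨X⟩ ⟨Y⟩ h
    exact Quotient.sound (isIsomorphic_of_toBounded Λ (Quotient.exact h))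
  refine Set.Finite.of_injOn (f := φ) ?_ hφ.injOn (hS.biUnion fun w _ => H w)
  rintro _ ⟨X, ⟨T, -, hT⟩, rfl⟩
  refine Set.mem_biUnion
    (x := fun i => K0.of ((tCohomology DerivedCategory.TStructure.t.onBounded i).obj
      ((toBounded Λ).obj X))) (fun i => ?_) ⟨(toBounded Λ).obj X, fun i => rfl, rfl⟩
  obtain ⟨M, hM, ⟨e⟩⟩ := exists_iso_tCohomology ((toBounded Λ).obj X) i
  exact ⟨M, hM.trans (hlen_toDerived_le_eulerK0 T hT i), (K0.of_eq_of_iso e).symm⟩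

end Discrete

end TriDiscrete

theorem mainTheorem5 (k : Type u') [Field k] (Λ : Type u) [Ring Λ] [Algebra k Λ]
    [Module.Finite k Λ] :
    have : IsNoetherianRing Λ := IsNoetherianRing.of_finite k Λ
    ∀ [HasDerivedCategory.{w} (FGModuleCat.{u} Λ)],
      TriDiscrete.IsDiscreteWrtHeart
          (DerivedCategory.TStructure.t : TStructure (DerivedCategory (FGModuleCat.{u} Λ))).onBounded →
        TriDiscrete.IsDiscreteWrtCoheart
          (TriDiscrete.stalkComplexes (TriDiscrete.FGProj.{u} Λ)) := by
  intro _ _ H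
  have := IsArtinianRing.of_finite k Λ
  exact TriDiscrete.isDiscreteWrtCoheart_of_isDiscreteWrtHeart Λ H
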